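/- Let $\mathcal X,\mathcal Y,\mathcal U$ be finite non-empty sets (states, measurements, controls), with transition probabilities $A^{x,\bar x}(u)$, measurement probabilities $B^x(y,u)$, an initial pmf $\pi_0$ on $\mathcal X$ and a discount factor $\gamma\in(0,1)$. Let $c:\mathcal X\times\mathcal X\times\mathcal U\to\mathbb R$ be arbitrary and let $\psi:\Delta(\mathcal X\times\mathcal X)\times\mathcal U\to\mathbb R$ be bounded below and otherwise arbitrary, where $\Delta(\mathcal S)$ denotes the set of pmfs on $\mathcal S$. A history policy $\mu\in\mathcal P$ chooses $U_k=\mu(Y^k,U^{k-1})\in\mathcal U$ as a deterministic function of $Y^k=(Y_1,\dots,Y_k)$ and $U^{k-1}=(U_0,\dots,U_{k-1})$. Let $E_\mu$ be the expectation under the law $p_\mu$ of the process with $X_0\sim\pi_0$, $X_{k+1}\mid X_k,U_k\sim A^{\cdot,X_k}(U_k)$, $Y_{k+1}\mid X_{k+1},U_k\sim B^{X_{k+1}}(\cdot,U_k)$, and let $\xi_k(x_0,x_k)=p_\mu(X_0=x_0,X_k=x_k\mid Y^k,U^{k-1})$. The ISC-POMDP is $$\inf_{\mu\in\mathcal P}J(\mu),\qquad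 J(\mu)=E_\mu\Big[\sum_{k\ge0}\gamma^k\big(c(X_0,X_k,U_k)+\psi(\xi_k,U_k)\big)\Big]\in(-\infty,\infty].$$ Put $\mathcal S=\mathcal X\times\mathcal X$, $\overline A^{(x_0,x),(\bar x_0,\bar x)}(u)=A^{x,\bar x}(u)$ if $x_0=\bar x_0$ and $0$ otherwise, $\overline B^{(x_0,x)}(y,u)=B^x(y,u)$, $$p(y\mid\xi,u)=\sum_{s,\bar s\in\mathcal S}\overline B^{s}(y,u)\overline A^{s,\bar s}(u)\xi(\bar s),\qquad \Xi(\xi,u,y)(s)=\frac{\overline B^{s}(y,u)\sum_{\bar s\in\mathcal S}\overline A^{s,\bar s}(u)\xi(\bar s)}{p(y\mid\xi,u)}$$ (with $\Xi(\xi,u,y)$ arbitrary if the denominator is $0$), and $\bar\rho(\xi,u)=\psi(\xi,u)+\sum_{(x_0,x)\in\mathcal S}\xi(x_0,x)c(x_0,x,u)$. For $\bar\mu:\Delta(\mathcal S)\to\mathcal U$ and $\xi_0\in\Delta(\mathcal S)$, let $\bar J(\bar\mu,\xi_0)=E_{\bar\mu}[\sum_{k\ge0}\gamma^k\bar\rho(\xi_k,U_k)]$,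 where $U_k=\bar\mu(\xi_k)$, $Y_{k+1}\mid\xi_k,U_k\sim p(\cdot\mid\xi_k,U_k)$ and $\xi_{k+1}=\Xi(\xi_k,U_k,Y_{k+1})$. The augmented-belief $\rho$-POMDP is $\inf_{\bar\mu}\bar J(\bar\mu,\xi_0)$ over all $\bar\mu:\Delta(\mathcal S)\to\mathcal U$. Let $\xi_0^{\pi_0}$ be the pmf of $(X_0,X_0)$. The ISC-POMDP is equivalent to the augmented-belief $\rho$-POMDP with $\xi_0=\xi_0^{\pi_0}$, in the following sense. 1. For every $\mu\in\mathcal P$, under $p_\mu$: $\xi_0=\xi_0^{\pi_0}$; $\xi_{k+1}=\Xi(\xi_k,U_k,Y_{k+1})$ almost surely for every $k$; $p_\mu(Y_{k+1}=y\mid y^k,u^{k-1})=p(y\mid\xi_k,\mu(y^k,u^{k-1}))$ for every history $(y^k,u^{k-1})$ of positive probability; and $J(\mu)=E_\mu[\sum_{k\ge0}\gamma^k\bar\rho(\xi_k,U_k)]$. 2. For every $\bar\mu:\Delta(\mathcal S)\to\mathcal U$, the history policy $U_k=\bar\mu(\xi_k)$, with $\xi_k$ computed from $(Y^k,U^{k-1})$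 by the recursion $\Xi$ from $\xi_0^{\pi_0}$, has $J$-cost $\bar J(\bar\mu,\xi_0^{\pi_0})$. 3. $\inf_{\mu\in\mathcal P}J(\mu)=\inf_{\bar\mu}\bar J(\bar\mu,\xi_0^{\pi_0})$. 4. There is a deterministic stationary policy $\bar\mu^*:\Delta(\mathcal S)\to\mathcal U$ (not depending on the initial condition) that minimizes $\bar J(\cdot,\xi_0)$ for every $\xi_0\in\Delta(\mathcal S)$ and whose induced history policy attains $\inf_{\mu\in\mathcal P}J(\mu)$ for every $\pi_0\in\Delta(\mathcal X)$. -/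

import Mathlib

open MeasureTheory ProbabilityTheory
open scoped ENNReal

section SequenceLaw

variable {E : Type*} [MeasurableSpace E] [Countable E] [DiscreteMeasurableSpace E]

/-- The Markov kernel of step `n + 1`: given the first `n + 1` terms of a sequence in `E`, draw the
next term from the conditional pmf `q (n + 1)`. -/
noncomputable def stepKernel (q : (n : ℕ) → (Fin n → E) → PMF E) (n : ℕ) :
    Kernel ((i : Finset.Iic n) → (fun _ : ℕ => E) i) E where
  toFun h := (q (n + 1)
    (fun i => h ⟨i, Finset.mem_Iic.2 (Nat.lt_succ_iff.1 i.2)⟩)).toMeasure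
  measurable' := Measurable.of_discrete

instance (q : (n : ℕ) → (Fin n → E) → PMF E) (n : ℕ) : IsMarkovKernel (stepKernel q n) :=
  ⟨fun _ => PMF.toMeasure.isProbabilityMeasure _⟩

/-- The law (Ionescu-Tulcea) on infinite sequences in `E` under which, for every `n`, the term of
index `n` has conditional pmf `q n` given the `n` preceding terms. -/
noncomputable def seqLaw (q : (n : ℕ) → (Fin n → E) → PMF E) : Measure (ℕ → E) :=
  Kernel.trajMeasure (X := fun _ => E) (q 0 Fin.elim0).toMeasure (stepKernel q)

instance (q : (n : ℕ) → (Fin n → E) → PMF E) : IsProbabilityMeasure (seqLaw q) := by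
  unfold seqLaw
  infer_instance

end SequenceLaw

/-- Expected total discounted cost `E[∑ₖ γᵏ gₖ]` in the extended reals, as the expectation of the
positive parts minus that of the negative parts. (No `∞ - ∞` occurs if `g` is bounded below.) -/
noncomputable def expectedDiscountedCost {Ω : Type*} [MeasurableSpace Ω] (P : Measure Ω) (γ : ℝ)
    (g : ℕ → Ω → ℝ) : EReal :=
  ((∫⁻ ω, ∑' k, ENNReal.ofReal (γ ^ k * g k ω) ∂P : ℝ≥0∞) : EReal) -
    ((∫⁻ ω, ∑' k, ENNReal.ofReal (-(γ ^ k * g k ω)) ∂P : ℝ≥0∞) : EReal)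

/-- The data of a partially observed Markov decision process with initial-state dependent costs,
apart from the initial pmf. Probability mass functions on a finite set are elements of `PMF`. -/
structure ISCPOMDP (X Y U : Type*) where
  /-- `A u x' x = p(X_{k+1} = x | X_k = x', U_k = u)` -/
  A : U → X → PMF X
  /-- `B u x y = p(Y_{k+1} = y | X_{k+1} = x, U_k = u)` -/
  B : U → X → PMF Y
  /-- the cost `c(X_0, X_k, U_k)` -/
  c : X → X → U → ℝ
  /-- the cost `ψ(ξ_k, U_k)` depending on the joint posterior of `(X_0, X_k)` -/
  ψ : PMF (X × X) → U → ℝ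
  /-- the discount factor -/
  γ : ℝ

/-- A deterministic history-dependent policy: `U_k = μ k (Y_1, …, Y_k) (U_0, …, U_{k-1})`. -/
abbrev HistoryPolicy (Y U : Type*) : Type _ :=
  (k : ℕ) → (Fin k → Y) → (Fin k → U) → U

/-- The sample space: the initial state `X_0` and the sequence of blocks
`(U_k, X_{k+1}, Y_{k+1})`, `k ≥ 0`. -/
abbrev Trajectory (X Y U : Type*) : Type _ := X × (ℕ → U × X × Y)

namespace Trajectory

variable {X Y U : Type*}

/-- The state `X_k`. -/
def state : ℕ → Trajectory X Y U → X
  | 0, ω => ω.1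
  | k + 1, ω => (ω.2 k).2.1

/-- The control `U_k`. -/
def control (k : ℕ) (ω : Trajectory X Y U) : U := (ω.2 k).1

/-- The measurements `(Y_1, …, Y_k)`; the entry of index `i` is `Y_{i+1}`. -/
def measurements (k : ℕ) (ω : Trajectory X Y U) : Fin k → Y := fun i => (ω.2 i).2.2

/-- The past controls `(U_0, …, U_{k-1})`. -/
def pastControls (k : ℕ) (ω : Trajectory X Y U) : Fin k → U := fun i => control i ω

/-- The event that `Y^k = ys` and `U^{k-1} = us`. -/
def historyEvent (k : ℕ) (ys : Fin k → Y) (us : Fin k → U) : Set (Trajectory X Y U) :=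
  {ω | measurements k ω = ys ∧ pastControls k ω = us}

theorem measurable_state [MeasurableSpace X] [MeasurableSpace Y] [MeasurableSpace U] (k : ℕ) :
    Measurable (state k : Trajectory X Y U → X) := by
  cases k with
  | zero => exact measurable_fst
  | succ k =>
    exact ((measurable_pi_apply k).comp measurable_snd).snd.fst

end Trajectory

namespace ISCPOMDP

variable {X Y U : Type*}

section Problem

variable [MeasurableSpace X] [Countable X] [DiscreteMeasurableSpace X]
  [MeasurableSpace Y] [Countable Y] [DiscreteMeasurableSpace Y]
  [MeasurableSpace U] [Countable U] [DiscreteMeasurableSpace U]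

/-- The state `X_n` read off from `X_0 = x₀` and the first `n` blocks. -/
def currentState (x₀ : X) : (n : ℕ) → (Fin n → U × X × Y) → X
  | 0, _ => x₀
  | n + 1, b => (b (Fin.last n)).2.1

/-- The conditional pmf of the block `(U_n, X_{n+1}, Y_{n+1})` given `X_0 = x₀` and the previous
blocks: `U_n = μ(Y^n, U^{n-1})`, `X_{n+1} ∼ A(· | X_n, U_n)`, `Y_{n+1} ∼ B(· | X_{n+1}, U_n)`. -/
noncomputable def blockPMF (M : ISCPOMDP X Y U) (μ : HistoryPolicy Y U) (x₀ : X) (n : ℕ)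
    (b : Fin n → U × X × Y) : PMF (U × X × Y) :=
  let u := μ n (fun i => (b i).2.2) (fun i => (b i).1)
  (M.A u (currentState x₀ n b)).bind fun x => (M.B u x).map fun y => (u, x, y)

/-- The law of the blocks given the initial state. -/
noncomputable def blockKernel (M : ISCPOMDP X Y U) (μ : HistoryPolicy Y U) :
    Kernel X (ℕ → U × X × Y) where
  toFun x₀ := seqLaw (M.blockPMF μ x₀)
  measurable' := Measurable.of_discrete

instance (M : ISCPOMDP X Y U) (μ : HistoryPolicy Y U) : IsMarkovKernel (M.blockKernel μ) :=
  ⟨fun x₀ => inferInstanceAs (IsProbabilityMeasure (seqLaw (M.blockPMF μ x₀)))⟩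

/-- The probability law `p_μ` of the controlled process with `X_0 ∼ π₀`. -/
noncomputable def law (M : ISCPOMDP X Y U) (π₀ : PMF X) (μ : HistoryPolicy Y U) :
    Measure (Trajectory X Y U) :=
  π₀.toMeasure ⊗ₘ M.blockKernel μ

instance (M : ISCPOMDP X Y U) (π₀ : PMF X) (μ : HistoryPolicy Y U) :
    IsProbabilityMeasure (M.law π₀ μ) := by
  unfold law
  infer_instance

/-- The initial augmented belief: the pmf of `(X_0, X_0)`. -/
noncomputable def initialBelief (π₀ : PMF X) : PMF (X × X) := π₀.map fun x => (x, x)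

open Classical in
/-- The joint posterior `p(X_0 = ·, X_k = · | y^k, u^{k-1})` under the law `p_μ` (with an arbitrary
value at histories of probability zero). -/
noncomputable def posterior (M : ISCPOMDP X Y U) (π₀ : PMF X) (μ : HistoryPolicy Y U) (k : ℕ)
    (ys : Fin k → Y) (us : Fin k → U) : PMF (X × X) :=
  if h : M.law π₀ μ (Trajectory.historyEvent k ys us) ≠ 0 then
    haveI := cond_isProbabilityMeasure h
    haveI : IsProbabilityMeasure
        (((M.law π₀ μ)[|Trajectory.historyEvent k ys us]).map
          fun ω => (Trajectory.state 0 ω, Trajectory.state k ω)) :=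
      Measure.isProbabilityMeasure_map ((Trajectory.measurable_state 0).prodMk
        (Trajectory.measurable_state k)).aemeasurable
    (((M.law π₀ μ)[|Trajectory.historyEvent k ys us]).map
      fun ω => (Trajectory.state 0 ω, Trajectory.state k ω)).toPMF
  else initialBelief π₀

/-- The random augmented belief `ξ_k`: the posterior at the realized history. -/
noncomputable def belief (M : ISCPOMDP X Y U) (π₀ : PMF X) (μ : HistoryPolicy Y U) (k : ℕ)
    (ω : Trajectory X Y U) : PMF (X × X) :=
  M.posterior π₀ μ k (Trajectory.measurements k ω) (Trajectory.pastControls k ω)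

/-- The cost functional of the ISC-POMDP:
`E_μ[∑ₖ γᵏ (c(X_0, X_k, U_k) + ψ(ξ_k, U_k))]`. -/
noncomputable def cost (M : ISCPOMDP X Y U) (π₀ : PMF X) (μ : HistoryPolicy Y U) : EReal :=
  expectedDiscountedCost (M.law π₀ μ) M.γ fun k ω =>
    M.c (Trajectory.state 0 ω) (Trajectory.state k ω) (Trajectory.control k ω) +
      M.ψ (M.belief π₀ μ k ω) (Trajectory.control k ω)

end Problem

section Augmented

/-- Transition pmf of the augmented state `(X_0, X_k)`: the first component stays fixed, the second
moves according to `A`. -/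
noncomputable def augA (M : ISCPOMDP X Y U) (u : U) (s : X × X) : PMF (X × X) :=
  (M.A u s.2).map fun x => (s.1, x)

/-- Measurement pmf given the augmented state. -/
noncomputable def augB (M : ISCPOMDP X Y U) (u : U) (s : X × X) : PMF Y := M.B u s.2

/-- The pmf `p(y_{k+1} | ξ_k, u_k)` of the next measurement:
`y ↦ ∑_{s', s} augB u s y * augA u s' s * ξ s'`. -/
noncomputable def nextMeasurement (M : ISCPOMDP X Y U) (ξ : PMF (X × X)) (u : U) : PMF Y :=
  (ξ.bind (M.augA u)).bind (M.augB u)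

variable [Fintype X]

/-- The numerator of the belief recursion. -/
noncomputable def filterWeight (M : ISCPOMDP X Y U) (ξ : PMF (X × X)) (u : U) (y : Y)
    (s : X × X) : ℝ≥0∞ :=
  M.augB u s y * ∑ s', M.augA u s' s * ξ s'

open Classical in
/-- The belief recursion `ξ_{k+1} = Ξ(ξ_k, u_k, y_{k+1})`: the normalized weights (the belief is left
unchanged when the measurement has probability zero; the total weight is never infinite). -/
noncomputable def filter (M : ISCPOMDP X Y U) (ξ : PMF (X × X)) (u : U) (y : Y) : PMF (X × X) :=
  if h : ∑' s, M.filterWeight ξ u y s ≠ 0 ∧ ∑' s, M.filterWeight ξ u y s ≠ ∞ then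
    PMF.normalize (M.filterWeight ξ u y) h.1 h.2
  else ξ

/-- The belief obtained by running the recursion along a history. -/
noncomputable def filterRun (M : ISCPOMDP X Y U) (ξ₀ : PMF (X × X)) :
    (k : ℕ) → (Fin k → Y) → (Fin k → U) → PMF (X × X)
  | 0, _, _ => ξ₀
  | k + 1, ys, us =>
    M.filter (filterRun M ξ₀ k (Fin.init ys) (Fin.init us)) (us (Fin.last k)) (ys (Fin.last k))

/-- The history-dependent policy `U_k = ν(ξ_k)` given by a belief policy `ν`, where `ξ_k` is
computed from the history by the recursion. -/
noncomputable def toHistoryPolicy (M : ISCPOMDP X Y U) (π₀ : PMF X) (ν : PMF (X × X) → U) :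
    HistoryPolicy Y U :=
  fun k ys us => ν (M.filterRun (initialBelief π₀) k ys us)

/-- The belief cost `ρ(ξ, u) = ψ(ξ, u) + ∑_s ξ(s) c(s, u)`. -/
noncomputable def rho (M : ISCPOMDP X Y U) (ξ : PMF (X × X)) (u : U) : ℝ :=
  M.ψ ξ u + ∑ s : X × X, (ξ s).toReal * M.c s.1 s.2 u

/-- The belief `ξ_k` in the belief MDP with controls `U_k = ν(ξ_k)`, as a function of
`(Y_1, …, Y_k)`. -/
noncomputable def closedLoopBelief (M : ISCPOMDP X Y U) (ξ₀ : PMF (X × X))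
    (ν : PMF (X × X) → U) : (k : ℕ) → (Fin k → Y) → PMF (X × X)
  | 0, _ => ξ₀
  | k + 1, ys =>
    M.filter (closedLoopBelief M ξ₀ ν k (Fin.init ys))
      (ν (closedLoopBelief M ξ₀ ν k (Fin.init ys))) (ys (Fin.last k))

variable [MeasurableSpace Y] [Countable Y] [DiscreteMeasurableSpace Y]

/-- The law of the measurements `(Y_1, Y_2, …)` in the belief MDP:
`Y_{k+1} | ξ_k, U_k ∼ p(· | ξ_k, U_k)` with `U_k = ν(ξ_k)`. -/
noncomputable def beliefLaw (M : ISCPOMDP X Y U) (ξ₀ : PMF (X × X)) (ν : PMF (X × X) → U) :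
    Measure (ℕ → Y) :=
  seqLaw fun k ys =>
    M.nextMeasurement (M.closedLoopBelief ξ₀ ν k ys) (ν (M.closedLoopBelief ξ₀ ν k ys))

/-- The cost functional of the augmented-belief `ρ`-POMDP: `E_ν[∑ₖ γᵏ ρ(ξ_k, U_k)]`. -/
noncomputable def beliefCost (M : ISCPOMDP X Y U) (ξ₀ : PMF (X × X)) (ν : PMF (X × X) → U) :
    EReal :=
  expectedDiscountedCost (M.beliefLaw ξ₀ ν) M.γ fun k ω =>
    M.rho (M.closedLoopBelief ξ₀ ν k fun i => ω i)
      (ν (M.closedLoopBelief ξ₀ ν k fun i => ω i))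

end Augmented

end ISCPOMDP

/-!
The augmented belief is a sufficient statistic, and the resulting control problem is solved by
monotone value iteration on nonnegative costs.

*Filtering.* By the Ionescu-Tulcea construction, integrating out the block `(U_n, X_{n+1}, Y_{n+1})`
under `p_μ` replaces it by its conditional pmf (`ISCPOMDP.lintegral_law_step`), and by the
definition of the posterior, integrating out `(X_0, X_k)` replaces it by an average against `ξ_k`
(`ISCPOMDP.lintegral_law_belief`). The two together are Bayes' rule: they give the belief recursion
(`ISCPOMDP.belief_succ_ae_eq`), the conditional pmf of the next measurement
(`ISCPOMDP.cond_historyEvent_next`) and the belief form of the cost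
(`ISCPOMDP.cost_eq_expectedDiscountedCost_rho`).

*Removing signs.* The costs are bounded below by some `-K`, and discounting makes the shift by `K`
cost a finite constant: the expected discounted cost is a `[0, ∞]`-valued total cost minus that
constant (`expectedDiscountedCost_eq_sub`). From there on no integrability is needed, which matters
because `ψ` may be unbounded above.

*Dynamic programming.* The process `(ξ_k, U_k)` under any history policy, and the closed loop of the
belief MDP under any belief policy, both satisfy the same one-step identity
(`BeliefMDP.IsControlled`). For such processes the supremum `V` of the finite-horizon values is a
lower bound for the cost (`BeliefMDP.IsControlled.value_le`). As the control set is finite, minima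
over controls commute with the increasing limit, so `V` satisfies the Bellman equation and a greedy
stationary policy exists, whose cost is exactly `V` (`BeliefMDP.IsControlled.cost_eq_value`). Under
a stationary belief policy the law of `ξ_k` is determined by iterating one operator
(`BeliefMDP.IsControlled.lintegral_eq_iterate`), so such a policy has the same cost in both
problems; hence both problems have the value `V` and the same greedy policy is optimal in both.
-/

/-! ### Integration against probability mass functions -/

theorem lintegral_comp_eq_sum {Ω H : Type*} [MeasurableSpace Ω] [Fintype H] [MeasurableSpace H]
    [DiscreteMeasurableSpace H] (P : Measure Ω) {Z : Ω → H} (hZ : Measurable Z) (F : H → ℝ≥0∞) :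
    ∫⁻ ω, F (Z ω) ∂P = ∑ a, F a * P {ω | Z ω = a} := by
  rw [← lintegral_map (f := F) (g := Z) Measurable.of_discrete hZ, lintegral_fintype]
  refine Finset.sum_congr rfl fun a _ => ?_
  rw [Measure.map_apply hZ (MeasurableSet.singleton a)]
  rfl

theorem PMF.lintegral_toMeasure {E : Type*} [MeasurableSpace E] [Countable E]
    [DiscreteMeasurableSpace E] (p : PMF E) (F : E → ℝ≥0∞) :
    ∫⁻ e, F e ∂p.toMeasure = ∑' e, p e * F e := by
  rw [lintegral_countable']
  refine tsum_congr fun e => ?_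
  rw [p.toMeasure_apply_singleton e (MeasurableSet.singleton e), mul_comm]

theorem PMF.tsum_bind_mul {α β : Type*} (p : PMF α) (f : α → PMF β) (F : β → ℝ≥0∞) :
    ∑' b, p.bind f b * F b = ∑' a, p a * ∑' b, f a b * F b := by
  simp_rw [PMF.bind_apply, ← ENNReal.tsum_mul_right, ← ENNReal.tsum_mul_left]
  rw [ENNReal.tsum_comm]
  simp_rw [mul_assoc]

theorem PMF.tsum_map_mul {α β : Type*} (p : PMF α) (g : α → β) (F : β → ℝ≥0∞) :
    ∑' b, p.map g b * F b = ∑' a, p a * F (g a) := by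
  classical
  rw [← PMF.bind_pure_comp, PMF.tsum_bind_mul]
  refine tsum_congr fun a => ?_
  congr 1
  rw [tsum_eq_single (g a)]
  · simp
  · intro b hb
    simp [hb]

/-! ### One-step integration under the law of a sequence -/

section SequenceLaw

variable {E : Type*} [MeasurableSpace E] [Countable E] [DiscreteMeasurableSpace E]

theorem map_eval_zero_seqLaw (q : (n : ℕ) → (Fin n → E) → PMF E) :
    (seqLaw q).map (fun ω => ω 0) = (q 0 Fin.elim0).toMeasure := by
  have h : (fun ω : ℕ → E => ω 0) =
      (MeasurableEquiv.piUnique (fun _ : Finset.Iic 0 => E)) ∘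
        (Preorder.frestrictLe (π := fun _ : ℕ => E) 0) := rfl
  rw [h, ← Measure.map_map (by fun_prop) (by fun_prop), seqLaw, Kernel.trajMeasure,
    Measure.map_comp _ _ (by fun_prop), Kernel.traj_map_frestrictLe, Kernel.partialTraj_self,
    Measure.id_comp]
  rw [Measure.map_map (by fun_prop) (by fun_prop)]
  exact Measure.map_id

/-- Tower property: the term of index `n` may be integrated out against its conditional pmf. -/
theorem lintegral_seqLaw (q : (n : ℕ) → (Fin n → E) → PMF E) (n : ℕ)
    (F : (Fin n → E) → E → ℝ≥0∞) :
    ∫⁻ ω, F (fun i => ω i) (ω n) ∂seqLaw q =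
      ∫⁻ ω, ∑' e, q n (fun i => ω i) e * F (fun i => ω i) e ∂seqLaw q := by
  cases n with
  | zero =>
    have h0 : ∀ ω : ℕ → E, (fun i : Fin 0 => ω i) = Fin.elim0 := fun ω => Subsingleton.elim _ _
    simp_rw [h0]
    rw [lintegral_const, measure_univ, mul_one, ← PMF.lintegral_toMeasure,
      ← map_eval_zero_seqLaw q, lintegral_map Measurable.of_discrete (by fun_prop)]
  | succ n =>
    let r : ((i : Finset.Iic n) → E) → (Fin (n + 1) → E) :=
      fun h i => h ⟨i, Finset.mem_Iic.2 (Nat.lt_succ_iff.1 i.2)⟩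
    have hm := Kernel.map_frestrictLe_trajMeasure_compProd_eq_map_trajMeasure
      (X := fun _ => E) (μ₀ := (q 0 Fin.elim0).toMeasure) (κ := stepKernel q) (a := n)
    have h1 : ∫⁻ ω, F (fun i => ω i) (ω (n + 1)) ∂seqLaw q =
        ∫⁻ z, F (r z.1) z.2 ∂((seqLaw q).map
          (fun x ↦ (Preorder.frestrictLe (π := fun _ : ℕ => E) n x, x (n + 1)))) := by
      rw [lintegral_map (by exact Measurable.of_discrete) (by fun_prop)]
      rfl
    rw [h1]
    unfold seqLaw
    rw [← hm, Measure.lintegral_compProd (by exact Measurable.of_discrete),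
      lintegral_map (by exact Measurable.of_discrete) (by fun_prop)]
    refine lintegral_congr fun ω => ?_
    exact PMF.lintegral_toMeasure _ _

end SequenceLaw

/-! ### Discounted costs that are bounded below -/

theorem ENNReal.ofReal_add_add_eq {a t : ℝ} (ht : 0 ≤ t) (h : -t ≤ a) :
    ENNReal.ofReal a + ENNReal.ofReal t = ENNReal.ofReal (a + t) + ENNReal.ofReal (-a) := by
  rcases le_total 0 a with ha | ha
  · rw [ENNReal.ofReal_of_nonpos (by linarith : -a ≤ 0), add_zero, ENNReal.ofReal_add ha ht]
  · rw [ENNReal.ofReal_of_nonpos ha, zero_add, ← ENNReal.ofReal_add (by linarith) (by linarith)]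
    congr 1; ring

theorem ENNReal.coe_sub_coe_eq_of_add_eq {a b c d : ℝ≥0∞} (hb : b ≠ ∞) (hd : d ≠ ∞)
    (h : a + d = c + b) : ((a : EReal) - (b : EReal)) = (c : EReal) - (d : EReal) := by
  lift b to NNReal using hb
  lift d to NNReal using hd
  induction a with
  | top =>
    induction c with
    | top => simp
    | coe c => exact absurd h.symm (ENNReal.add_ne_top.2 ⟨ENNReal.coe_ne_top, ENNReal.coe_ne_top⟩)
  | coe a =>
    induction c with
    | top => exact absurd h (ENNReal.add_ne_top.2 ⟨ENNReal.coe_ne_top, ENNReal.coe_ne_top⟩)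
    | coe c =>
      have h' : (a : ℝ) + d = c + b := by exact_mod_cast h
      have hsub : (a : ℝ) - b = c - d := by linarith
      exact congrArg Real.toEReal hsub

/-- Shifting running costs `≥ -K` by `K` turns the expected discounted cost into a nonnegative total
cost minus the finite constant `K / (1 - γ)`. -/
theorem expectedDiscountedCost_eq_sub {Ω : Type*} [MeasurableSpace Ω] (P : Measure Ω)
    [IsProbabilityMeasure P] {γ K : ℝ} (hγ : 0 ≤ γ) (hγ' : γ < 1) (hK : 0 ≤ K) {g : ℕ → Ω → ℝ}
    (hm : ∀ k, Measurable (g k)) (hg : ∀ k ω, -K ≤ g k ω) :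
    expectedDiscountedCost P γ g =
      ((∑' k, ENNReal.ofReal γ ^ k * ∫⁻ ω, ENNReal.ofReal (g k ω + K) ∂P : ℝ≥0∞) : EReal) -
        ((∑' k, ENNReal.ofReal γ ^ k * ENNReal.ofReal K : ℝ≥0∞) : EReal) := by
  have hC : ∑' k, ENNReal.ofReal γ ^ k * ENNReal.ofReal K ≠ ∞ := by
    rw [ENNReal.tsum_mul_right, ENNReal.tsum_geometric]
    refine ENNReal.mul_ne_top ?_ ENNReal.ofReal_ne_top
    rw [ENNReal.inv_ne_top]
    exact (tsub_pos_of_lt (by simpa using hγ')).ne'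
  have hpow : ∀ k, (0 : ℝ) ≤ γ ^ k := fun k => pow_nonneg hγ k
  have hN : ∫⁻ ω, ∑' k, ENNReal.ofReal (-(γ ^ k * g k ω)) ∂P ≠ ∞ := by
    refine ne_top_of_le_ne_top hC ?_
    calc ∫⁻ ω, ∑' k, ENNReal.ofReal (-(γ ^ k * g k ω)) ∂P
        ≤ ∫⁻ _, ∑' k, ENNReal.ofReal γ ^ k * ENNReal.ofReal K ∂P := by
          refine lintegral_mono fun ω => ENNReal.tsum_le_tsum fun k => ?_
          rw [← ENNReal.ofReal_pow hγ, ← ENNReal.ofReal_mul (hpow k)]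
          refine ENNReal.ofReal_le_ofReal ?_
          nlinarith [hpow k, hg k ω]
      _ = _ := by simp
  refine ENNReal.coe_sub_coe_eq_of_add_eq hN hC ?_
  have hH : ∑' k, ENNReal.ofReal γ ^ k * ∫⁻ ω, ENNReal.ofReal (g k ω + K) ∂P =
      ∫⁻ ω, ∑' k, ENNReal.ofReal (γ ^ k * g k ω + γ ^ k * K) ∂P := by
    rw [lintegral_tsum fun k => by have := hm k; fun_prop]
    refine tsum_congr fun k => ?_
    have := hm k
    rw [← lintegral_const_mul _ (by fun_prop)]
    refine lintegral_congr fun ω => ?_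
    rw [← ENNReal.ofReal_pow hγ, ← ENNReal.ofReal_mul (hpow k), mul_add]
  rw [hH, ← lintegral_add_left (by have := hm; fun_prop)]
  have hC' : ∑' k, ENNReal.ofReal γ ^ k * ENNReal.ofReal K =
      ∫⁻ _, ∑' k, ENNReal.ofReal (γ ^ k * K) ∂P := by
    rw [lintegral_const, measure_univ, mul_one]
    exact tsum_congr fun k => by rw [← ENNReal.ofReal_pow hγ, ← ENNReal.ofReal_mul (hpow k)]
  rw [hC', ← lintegral_add_right _ (by fun_prop)]
  refine lintegral_congr fun ω => ?_
  rw [← ENNReal.tsum_add, ← ENNReal.tsum_add]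
  refine tsum_congr fun k => ENNReal.ofReal_add_add_eq (mul_nonneg (hpow k) hK) ?_
  nlinarith [hpow k, hg k ω]

/-! ### Dynamic programming with nonnegative costs -/

/-- A Markov decision process whose state is updated by a deterministic function of a random
measurement, with running costs in `[0, ∞]`. -/
structure BeliefMDP (S U Y : Type*) where
  /-- the pmf of the next measurement -/
  p : S → U → PMF Y
  /-- the state reached after a measurement -/
  next : S → U → Y → S
  /-- the running cost -/
  h : S → U → ℝ≥0∞
  /-- the discount factor; no bound on it is imposed -/
  γ : ℝ≥0∞

namespace BeliefMDP

variable {S U Y : Type*} [Fintype Y] (D : BeliefMDP S U Y)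

/-- The expectation of `F` at the next state, given the current state and control. -/
noncomputable def expNext (F : S → ℝ≥0∞) (ξ : S) (u : U) : ℝ≥0∞ :=
  ∑ y, D.p ξ u y * F (D.next ξ u y)

/-- The cost of applying `u` once at `ξ` and then paying the discounted terminal cost `F`. -/
noncomputable def qValue (F : S → ℝ≥0∞) (ξ : S) (u : U) : ℝ≥0∞ :=
  D.h ξ u + D.γ * D.expNext F ξ u

/-- The optimal cost over `n` steps: value iteration started at `0`. -/
noncomputable def horizonValue : ℕ → S → ℝ≥0∞
  | 0, _ => 0
  | n + 1, ξ => ⨅ u, D.qValue (horizonValue n) ξ u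

/-- The limit of value iteration, which is a supremum because the costs are nonnegative. It is the
optimal total cost when the control set is finite. -/
noncomputable def value (ξ : S) : ℝ≥0∞ := ⨆ n, D.horizonValue n ξ

/-- The processes `ξ` and `u` are the states and controls of a run of the decision process under
`P`, in the weak sense that suffices for dynamic programming: the one-step identity holds for
expectations of functions of the next state. How `u` depends on the past is unrestricted. The state space carries
no σ-algebra; measurability is with respect to the discrete one. -/
structure IsControlled {Ω : Type*} [MeasurableSpace Ω] (P : Measure Ω) (ξ : ℕ → Ω → S)
    (u : ℕ → Ω → U) : Prop where
  measurable : ∀ k : ℕ, Measurable[_, ⊤] fun ω => (ξ k ω, u k ω)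
  lintegral_next : ∀ (k : ℕ) (F : S → ℝ≥0∞),
    ∫⁻ ω, F (ξ (k + 1) ω) ∂P = ∫⁻ ω, D.expNext F (ξ k ω) (u k ω) ∂P

variable {D}

theorem expNext_mono {F G : S → ℝ≥0∞} (h : ∀ ξ, F ξ ≤ G ξ) (ξ : S) (u : U) :
    D.expNext F ξ u ≤ D.expNext G ξ u :=
  Finset.sum_le_sum fun _ _ => by gcongr; exact h _

theorem qValue_mono {F G : S → ℝ≥0∞} (h : ∀ ξ, F ξ ≤ G ξ) (ξ : S) (u : U) :
    D.qValue F ξ u ≤ D.qValue G ξ u := by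
  unfold qValue
  gcongr
  exact expNext_mono h ξ u

theorem horizonValue_mono (ξ : S) : Monotone fun n => D.horizonValue n ξ := by
  refine monotone_nat_of_le_succ fun n => ?_
  induction n generalizing ξ with
  | zero => exact zero_le
  | succ n ih => exact iInf_mono fun u => qValue_mono ih ξ u

/-- The expectation of the value at the next state is a finite sum, so it commutes with the
increasing limit of value iteration. -/
theorem qValue_value (ξ : S) (u : U) :
    D.qValue D.value ξ u = ⨆ n, D.qValue (D.horizonValue n) ξ u := by
  have h : D.expNext D.value ξ u = ⨆ n, D.expNext (D.horizonValue n) ξ u := by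
    unfold expNext value
    simp_rw [ENNReal.mul_iSup]
    exact ENNReal.finsetSum_iSup_of_monotone fun y m n hmn => by
      gcongr; exact horizonValue_mono _ hmn
  unfold qValue
  rw [h, ENNReal.mul_iSup, ENNReal.add_iSup]

section Greedy

variable [Finite U]

/-- The Bellman equation. -/
theorem iInf_qValue_value (ξ : S) : ⨅ u, D.qValue D.value ξ u = D.value ξ := by
  simp_rw [qValue_value]
  rw [← iSup_iInf_of_monotone fun u m n hmn =>
    qValue_mono (fun ξ' => horizonValue_mono ξ' hmn) ξ u]
  exact (horizonValue_mono ξ).iSup_nat_add 1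

theorem exists_greedy [Nonempty U] (D : BeliefMDP S U Y) :
    ∃ ν : S → U, ∀ ξ, D.qValue D.value ξ (ν ξ) = D.value ξ := by
  choose ν hν using fun ξ => exists_eq_ciInf_of_finite (f := D.qValue D.value ξ)
  exact ⟨ν, fun ξ => (hν ξ).trans (iInf_qValue_value ξ)⟩

end Greedy

namespace IsControlled

variable {Ω : Type*} [MeasurableSpace Ω] {P : Measure Ω} {ξ : ℕ → Ω → S} {u : ℕ → Ω → U}

theorem measurable_comp {β : Type*} [MeasurableSpace β] (hP : D.IsControlled P ξ u) (k : ℕ)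
    (F : S → U → β) : Measurable fun ω => F (ξ k ω) (u k ω) :=
  (measurable_from_top (f := fun z : S × U => F z.1 z.2)).comp (hP.measurable k)

theorem lintegral_qValue (hP : D.IsControlled P ξ u) (F : S → ℝ≥0∞) (k : ℕ) :
    ∫⁻ ω, D.qValue F (ξ k ω) (u k ω) ∂P =
      ∫⁻ ω, D.h (ξ k ω) (u k ω) ∂P + D.γ * ∫⁻ ω, F (ξ (k + 1) ω) ∂P := by
  unfold qValue
  rw [lintegral_add_left (hP.measurable_comp k D.h), lintegral_const_mul _ (hP.measurable_comp k _),
    hP.lintegral_next]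

/-- No control process beats the `n`-step value; the start time `j` is general for the induction
on `n`. -/
theorem horizonValue_le (hP : D.IsControlled P ξ u) (n j : ℕ) :
    ∫⁻ ω, D.horizonValue n (ξ j ω) ∂P ≤
      ∑ k ∈ Finset.range n, D.γ ^ k * ∫⁻ ω, D.h (ξ (j + k) ω) (u (j + k) ω) ∂P := by
  induction n generalizing j with
  | zero => simp [horizonValue]
  | succ n ih =>
    calc ∫⁻ ω, D.horizonValue (n + 1) (ξ j ω) ∂P
        ≤ ∫⁻ ω, D.qValue (D.horizonValue n) (ξ j ω) (u j ω) ∂P :=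
          lintegral_mono fun ω => iInf_le _ _
      _ = ∫⁻ ω, D.h (ξ j ω) (u j ω) ∂P + D.γ * ∫⁻ ω, D.horizonValue n (ξ (j + 1) ω) ∂P :=
          hP.lintegral_qValue _ _
      _ ≤ _ := by
          rw [Finset.sum_range_succ', add_comm]
          simp only [pow_zero, one_mul, add_zero]
          gcongr
          refine (mul_le_mul_right (ih (j + 1)) D.γ).trans_eq ?_
          rw [Finset.mul_sum]
          refine Finset.sum_congr rfl fun k _ => ?_
          rw [pow_succ', mul_assoc, add_right_comm, add_assoc]

theorem value_le [IsProbabilityMeasure P] (hP : D.IsControlled P ξ u) {ξ₀ : S}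
    (h₀ : ∀ ω, ξ 0 ω = ξ₀) :
    D.value ξ₀ ≤ ∑' k, D.γ ^ k * ∫⁻ ω, D.h (ξ k ω) (u k ω) ∂P := by
  refine iSup_le fun n => ?_
  have h := hP.horizonValue_le n 0
  simp only [h₀, lintegral_const, measure_univ, mul_one, zero_add] at h
  exact h.trans (ENNReal.sum_le_tsum _)

theorem sum_le_value (hP : D.IsControlled P ξ u) {ν : S → U} (hu : ∀ k, ∀ᵐ ω ∂P, u k ω = ν (ξ k ω))
    (hν : ∀ ξ, D.qValue D.value ξ (ν ξ) = D.value ξ) (n j : ℕ) :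
    ∑ k ∈ Finset.range n, D.γ ^ k * ∫⁻ ω, D.h (ξ (j + k) ω) (u (j + k) ω) ∂P ≤
      ∫⁻ ω, D.value (ξ j ω) ∂P := by
  induction n generalizing j with
  | zero => simp
  | succ n ih =>
    have hV : ∫⁻ ω, D.value (ξ j ω) ∂P = ∫⁻ ω, D.qValue D.value (ξ j ω) (u j ω) ∂P :=
      lintegral_congr_ae ((hu j).mono fun ω hω => by simp only [hω, hν])
    rw [hV, hP.lintegral_qValue, Finset.sum_range_succ', add_comm]
    simp only [pow_zero, one_mul, add_zero]
    gcongr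
    refine Eq.trans_le ?_ (mul_le_mul_right (ih (j + 1)) D.γ)
    rw [Finset.mul_sum]
    refine Finset.sum_congr rfl fun k _ => ?_
    rw [pow_succ', mul_assoc, add_right_comm, add_assoc]

/-- Greedy controls attain the value: no transversality condition is needed, because
the costs are nonnegative. -/
theorem cost_eq_value [IsProbabilityMeasure P] (hP : D.IsControlled P ξ u) {ξ₀ : S}
    (h₀ : ∀ ω, ξ 0 ω = ξ₀) {ν : S → U} (hu : ∀ k, ∀ᵐ ω ∂P, u k ω = ν (ξ k ω))
    (hν : ∀ ξ, D.qValue D.value ξ (ν ξ) = D.value ξ) :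
    ∑' k, D.γ ^ k * ∫⁻ ω, D.h (ξ k ω) (u k ω) ∂P = D.value ξ₀ := by
  refine le_antisymm ?_ (hP.value_le h₀)
  rw [ENNReal.tsum_eq_iSup_nat]
  refine iSup_le fun n => ?_
  have h := hP.sum_le_value hu hν n 0
  simpa only [h₀, lintegral_const, measure_univ, mul_one, zero_add] using h

/-- Under a stationary policy, the distribution of `ξ_k` depends only on the policy and the initial
state, whatever the probability space carrying the process. -/
theorem lintegral_eq_iterate [IsProbabilityMeasure P] (hP : D.IsControlled P ξ u) {ξ₀ : S}
    (h₀ : ∀ ω, ξ 0 ω = ξ₀) {ν : S → U} (hu : ∀ k, ∀ᵐ ω ∂P, u k ω = ν (ξ k ω)) (k : ℕ)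
    (F : S → ℝ≥0∞) :
    ∫⁻ ω, F (ξ k ω) ∂P = (fun G s => D.expNext G s (ν s))^[k] F ξ₀ := by
  induction k generalizing F with
  | zero => simp [h₀]
  | succ k ih =>
    rw [hP.lintegral_next, Function.iterate_succ_apply, ← ih]
    exact lintegral_congr_ae ((hu k).mono fun ω hω => by simp only [hω])

end IsControlled

end BeliefMDP

/-! ### The filtering identities of the controlled process -/

namespace Trajectory

variable {X Y U : Type*} [MeasurableSpace X] [MeasurableSpace Y] [MeasurableSpace U]

theorem measurable_control (k : ℕ) : Measurable (control k : Trajectory X Y U → U) := by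
  unfold control
  fun_prop

theorem measurable_measurements (k : ℕ) :
    Measurable (measurements k : Trajectory X Y U → Fin k → Y) := by
  unfold measurements
  fun_prop

theorem measurable_pastControls (k : ℕ) :
    Measurable (pastControls k : Trajectory X Y U → Fin k → U) :=
  measurable_pi_lambda _ fun _ => measurable_control _

theorem measurable_history_control (k : ℕ) : Measurable fun ω : Trajectory X Y U =>
    ((measurements k ω, pastControls k ω), control k ω) :=
  ((measurable_measurements k).prodMk (measurable_pastControls k)).prodMk (measurable_control k)

theorem measurableSet_historyEvent [Countable Y] [DiscreteMeasurableSpace Y] [Countable U]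
    [DiscreteMeasurableSpace U] (k : ℕ) (ys : Fin k → Y) (us : Fin k → U) :
    MeasurableSet (historyEvent k ys us : Set (Trajectory X Y U)) :=
  (measurable_measurements k (MeasurableSet.singleton ys)).inter
    (measurable_pastControls k (MeasurableSet.singleton us))

end Trajectory

namespace ISCPOMDP

open Trajectory

section Kernels

variable {X Y U : Type*}

theorem currentState_eq_state (ω : Trajectory X Y U) (n : ℕ) :
    currentState ω.1 n (fun i => ω.2 i) = state n ω := by
  cases n <;> rfl

open Classical in
theorem augA_apply (M : ISCPOMDP X Y U) (u : U) (s t : X × X) :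
    M.augA u s t = if s.1 = t.1 then M.A u s.2 t.2 else 0 := by
  unfold augA
  rw [PMF.map_apply]
  split_ifs with h
  · rw [tsum_eq_single t.2]
    · exact if_pos (by rw [h])
    · exact fun x hx => if_neg fun e => hx (by rw [e])
  · exact ENNReal.tsum_eq_zero.2 fun x => if_neg fun e => h (by rw [e])

theorem nextMeasurement_apply [Fintype X] (M : ISCPOMDP X Y U) (ξ : PMF (X × X)) (u : U) (y : Y) :
    M.nextMeasurement ξ u y = ∑ s, ξ s * ∑ x, M.A u s.2 x * M.B u x y := by
  unfold nextMeasurement augA augB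
  rw [PMF.bind_apply, PMF.tsum_bind_mul, tsum_fintype]
  refine Finset.sum_congr rfl fun s _ => ?_
  rw [PMF.tsum_map_mul, tsum_fintype]

theorem tsum_blockPMF_mul [Fintype X] [Fintype Y] (M : ISCPOMDP X Y U) (μ : HistoryPolicy Y U)
    (x₀ : X) (n : ℕ) (b : Fin n → U × X × Y) (F : U × X × Y → ℝ≥0∞) :
    ∑' e, M.blockPMF μ x₀ n b e * F e =
      ∑ x, ∑ y, M.A (μ n (fun i => (b i).2.2) (fun i => (b i).1)) (currentState x₀ n b) x *
        (M.B (μ n (fun i => (b i).2.2) (fun i => (b i).1)) x y *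
          F (μ n (fun i => (b i).2.2) (fun i => (b i).1), x, y)) := by
  unfold blockPMF
  rw [PMF.tsum_bind_mul, tsum_fintype]
  simp_rw [PMF.tsum_map_mul, tsum_fintype, Finset.mul_sum]

end Kernels

variable {X Y U : Type*} [Fintype X] [MeasurableSpace X] [DiscreteMeasurableSpace X]
  [Fintype Y] [MeasurableSpace Y] [DiscreteMeasurableSpace Y]
  [Fintype U] [MeasurableSpace U] [DiscreteMeasurableSpace U]

/-- Tower property under `p_μ`: the block `(U_n, X_{n+1}, Y_{n+1})` may be integrated out. -/
theorem lintegral_law_step (M : ISCPOMDP X Y U) (π₀ : PMF X) (μ : HistoryPolicy Y U) (n : ℕ)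
    (F : (Fin n → Y) → (Fin n → U) → X → X → U → X → Y → ℝ≥0∞) :
    ∫⁻ ω, F (measurements n ω) (pastControls n ω) (state 0 ω) (state n ω) (control n ω)
        (state (n + 1) ω) (ω.2 n).2.2 ∂M.law π₀ μ =
      ∫⁻ ω, ∑ x, ∑ y, M.A (μ n (measurements n ω) (pastControls n ω)) (state n ω) x *
        (M.B (μ n (measurements n ω) (pastControls n ω)) x y *
          F (measurements n ω) (pastControls n ω) (state 0 ω) (state n ω)
            (μ n (measurements n ω) (pastControls n ω)) x y) ∂M.law π₀ μ := by
  have key : ∀ G : X → (Fin n → U × X × Y) → U × X × Y → ℝ≥0∞,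
      ∫⁻ ω, G ω.1 (fun i => ω.2 i) (ω.2 n) ∂M.law π₀ μ =
        ∫⁻ ω, ∑' e, M.blockPMF μ ω.1 n (fun i => ω.2 i) e * G ω.1 (fun i => ω.2 i) e
          ∂M.law π₀ μ := by
    intro G
    have hm : ∀ H : X → (Fin n → U × X × Y) → U × X × Y → ℝ≥0∞,
        Measurable fun ω : Trajectory X Y U => H ω.1 (fun i => ω.2 i) (ω.2 n) := by
      intro H
      have h1 : Measurable fun z : X × (Fin n → U × X × Y) × (U × X × Y) => H z.1 z.2.1 z.2.2 :=
        Measurable.of_discrete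
      exact h1.comp (g := fun z : X × (Fin n → U × X × Y) × (U × X × Y) => H z.1 z.2.1 z.2.2)
        (f := fun ω : Trajectory X Y U => (ω.1, (fun i => ω.2 i), ω.2 n)) (by fun_prop)
    unfold law
    rw [Measure.lintegral_compProd (hm G), Measure.lintegral_compProd
      (hm fun x₀ b _ => ∑' e, M.blockPMF μ x₀ n b e * G x₀ b e)]
    exact lintegral_congr fun x₀ => lintegral_seqLaw (M.blockPMF μ x₀) n (G x₀)
  have h := key fun x₀ b e => F (fun i => (b i).2.2) (fun i => (b i).1) x₀
    (currentState x₀ n b) e.1 e.2.1 e.2.2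
  simp only [tsum_blockPMF_mul, currentState_eq_state] at h
  exact h

/-- The defining property of the posterior, valid for histories of probability zero as well. -/
theorem law_historyEvent_inter (M : ISCPOMDP X Y U) (π₀ : PMF X) (μ : HistoryPolicy Y U) (k : ℕ)
    (ys : Fin k → Y) (us : Fin k → U) (s : X × X) :
    M.law π₀ μ (historyEvent k ys us ∩ {ω | (state 0 ω, state k ω) = s}) =
      M.law π₀ μ (historyEvent k ys us) * M.posterior π₀ μ k ys us s := by
  by_cases h : M.law π₀ μ (historyEvent k ys us) = 0
  · rw [h, zero_mul]
    exact measure_mono_null Set.inter_subset_left h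
  · have hH : MeasurableSet (historyEvent k ys us : Set (Trajectory X Y U)) :=
      (measurable_measurements k (MeasurableSet.singleton ys)).inter
        (measurable_pastControls k (MeasurableSet.singleton us))
    rw [posterior, dif_pos h, Measure.toPMF_apply,
      Measure.map_apply ((measurable_state 0).prodMk (measurable_state k))
        (MeasurableSet.singleton s), cond_apply hH, ← mul_assoc,
      ENNReal.mul_inv_cancel h (measure_ne_top _ _), one_mul]
    rfl

/-- The pair `(X_0, X_k)` may be integrated out against the belief `ξ_k`. -/
theorem lintegral_law_belief (M : ISCPOMDP X Y U) (π₀ : PMF X) (μ : HistoryPolicy Y U) (k : ℕ)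
    (F : (Fin k → Y) → (Fin k → U) → X → X → ℝ≥0∞) :
    ∫⁻ ω, F (measurements k ω) (pastControls k ω) (state 0 ω) (state k ω) ∂M.law π₀ μ =
      ∫⁻ ω, ∑ s : X × X, M.belief π₀ μ k ω s *
        F (measurements k ω) (pastControls k ω) s.1 s.2 ∂M.law π₀ μ := by
  classical
  have hh : Measurable fun ω : Trajectory X Y U => (measurements k ω, pastControls k ω) :=
    (measurable_measurements k).prodMk (measurable_pastControls k)
  have hs : Measurable fun ω : Trajectory X Y U => (state 0 ω, state k ω) :=
    (measurable_state 0).prodMk (measurable_state k)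
  have e1 := lintegral_comp_eq_sum (M.law π₀ μ) (hh.prodMk hs)
    fun z : ((Fin k → Y) × (Fin k → U)) × (X × X) => F z.1.1 z.1.2 z.2.1 z.2.2
  have e2 := lintegral_comp_eq_sum (M.law π₀ μ) hh
    fun z : (Fin k → Y) × (Fin k → U) => ∑ s : X × X, M.posterior π₀ μ k z.1 z.2 s *
        F z.1 z.2 s.1 s.2
  refine e1.trans (Eq.trans ?_ e2.symm)
  rw [Fintype.sum_prod_type]
  refine Finset.sum_congr rfl fun z _ => ?_
  rw [Finset.sum_mul]
  refine Finset.sum_congr rfl fun s _ => ?_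
  have h1 : {ω : Trajectory X Y U | ((measurements k ω, pastControls k ω), state 0 ω, state k ω)
      = (z, s)} = historyEvent k z.1 z.2 ∩ {ω | (state 0 ω, state k ω) = s} := by
    ext ω
    simp [historyEvent, Prod.ext_iff]
  have h2 : {ω : Trajectory X Y U | (measurements k ω, pastControls k ω) = z} =
      historyEvent k z.1 z.2 := by
    ext ω
    simp [historyEvent, Prod.ext_iff]
  rw [h1, h2, law_historyEvent_inter]
  ring

theorem control_ae_eq (M : ISCPOMDP X Y U) (π₀ : PMF X) (μ : HistoryPolicy Y U) (k : ℕ) :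
    ∀ᵐ ω ∂M.law π₀ μ, control k ω = μ k (measurements k ω) (pastControls k ω) := by
  classical
  have h := M.lintegral_law_step π₀ μ k
    fun ys us _ _ u _ _ => if u = μ k ys us then 0 else 1
  simp only [if_true, mul_zero, Finset.sum_const_zero, lintegral_zero] at h
  rw [lintegral_eq_zero_iff] at h
  · filter_upwards [h] with ω hω
    by_contra hne
    simp [hne] at hω
  · have h1 : Measurable fun z : ((Fin k → Y) × (Fin k → U)) × U =>
        if z.2 = μ k z.1.1 z.1.2 then (0 : ℝ≥0∞) else 1 := Measurable.of_discrete
    exact h1.comp (((measurable_measurements k).prodMk (measurable_pastControls k)).prodMk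
      (measurable_control k))

/-- Given the history, the next measurement has the pmf `p(· | ξ_k, U_k)`. -/
theorem lintegral_law_next (M : ISCPOMDP X Y U) (π₀ : PMF X) (μ : HistoryPolicy Y U) (k : ℕ)
    (F : (Fin k → Y) → (Fin k → U) → U → Y → ℝ≥0∞) :
    ∫⁻ ω, F (measurements k ω) (pastControls k ω) (control k ω) (ω.2 k).2.2 ∂M.law π₀ μ =
      ∫⁻ ω, ∑ y, M.nextMeasurement (M.belief π₀ μ k ω)
        (μ k (measurements k ω) (pastControls k ω)) y *
        F (measurements k ω) (pastControls k ω) (μ k (measurements k ω) (pastControls k ω)) y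
          ∂M.law π₀ μ := by
  refine (M.lintegral_law_step π₀ μ k fun ys us _ _ u _ y => F ys us u y).trans ?_
  refine (M.lintegral_law_belief π₀ μ k fun ys us _ x' => ∑ x, ∑ y,
    M.A (μ k ys us) x' x * (M.B (μ k ys us) x y * F ys us (μ k ys us) y)).trans ?_
  refine lintegral_congr fun ω => ?_
  simp_rw [nextMeasurement_apply, Finset.sum_mul, Finset.mul_sum, Finset.sum_mul]
  refine Eq.trans ?_ Finset.sum_comm
  refine Finset.sum_congr rfl fun s _ => ?_
  refine Finset.sum_comm.trans ?_
  refine Finset.sum_congr rfl fun y _ => Finset.sum_congr rfl fun x _ => ?_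
  ring

/-- Bayes' rule before normalization: along a history consistent with the policy, the joint
probability of the extended history and of `(X_0, X_{k+1}) = s` is the filter weight times the
probability of the old history. -/
theorem law_historyEvent_succ_inter (M : ISCPOMDP X Y U) (π₀ : PMF X) (μ : HistoryPolicy Y U)
    (k : ℕ) (ys : Fin (k + 1) → Y) (us : Fin (k + 1) → U)
    (hus : us (Fin.last k) = μ k (Fin.init ys) (Fin.init us)) (s : X × X) :
    M.law π₀ μ (historyEvent (k + 1) ys us ∩ {ω | (state 0 ω, state (k + 1) ω) = s}) =
      M.law π₀ μ (historyEvent k (Fin.init ys) (Fin.init us)) *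
        M.filterWeight (M.posterior π₀ μ k (Fin.init ys) (Fin.init us))
          (us (Fin.last k)) (ys (Fin.last k)) s := by
  classical
  have hE : MeasurableSet (historyEvent (k + 1) ys us ∩
      {ω : Trajectory X Y U | (state 0 ω, state (k + 1) ω) = s}) :=
    (measurableSet_historyEvent _ _ _).inter (((measurable_state 0).prodMk
      (measurable_state (k + 1))) (MeasurableSet.singleton s))
  let F : (Fin k → Y) → (Fin k → U) → X → X → U → X → Y → ℝ≥0∞ := fun ys' us' x₀ _ u x y =>
    if (ys' = Fin.init ys ∧ us' = Fin.init us) ∧ u = us (Fin.last k) ∧ y = ys (Fin.last k) ∧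
      x₀ = s.1 ∧ x = s.2 then 1 else 0
  have h1 : M.law π₀ μ (historyEvent (k + 1) ys us ∩ {ω | (state 0 ω, state (k + 1) ω) = s}) =
      ∫⁻ ω, F (measurements k ω) (pastControls k ω) (state 0 ω) (state k ω) (control k ω)
        (state (k + 1) ω) (ω.2 k).2.2 ∂M.law π₀ μ := by
    rw [← lintegral_indicator_one hE]
    refine lintegral_congr fun ω => ?_
    have e1 : measurements (k + 1) ω = ys ↔
        measurements k ω = Fin.init ys ∧ (ω.2 k).2.2 = ys (Fin.last k) := by
      rw [← Fin.snoc_init_self ys, ← Fin.snoc_init_self (measurements (k + 1) ω)]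
      simp only [Fin.snoc_injective2.eq_iff, Fin.init_snoc, Fin.snoc_last]
      rfl
    have e2 : pastControls (k + 1) ω = us ↔
        pastControls k ω = Fin.init us ∧ control k ω = us (Fin.last k) := by
      rw [← Fin.snoc_init_self us, ← Fin.snoc_init_self (pastControls (k + 1) ω)]
      simp only [Fin.snoc_injective2.eq_iff, Fin.init_snoc, Fin.snoc_last]
      rfl
    simp only [F, Set.indicator_apply, historyEvent, Set.mem_inter_iff, Set.mem_ofPred_eq, e1, e2,
      Prod.ext_iff, Pi.one_apply]
    refine if_congr ?_ rfl rfl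
    tauto
  rw [h1, M.lintegral_law_step π₀ μ k F]
  refine (M.lintegral_law_belief π₀ μ k fun ys us x₀ x' => ∑ x, ∑ y,
    M.A (μ k ys us) x' x * (M.B (μ k ys us) x y * F ys us x₀ x' (μ k ys us) x y)).trans ?_
  rw [mul_comm, ← lintegral_indicator_const (measurableSet_historyEvent _ _ _)]
  refine lintegral_congr fun ω => ?_
  rw [Set.indicator_apply]
  split_ifs with hω
  · obtain ⟨hy, hu⟩ := hω
    unfold belief filterWeight
    simp only [F, hy, hu, ← hus, true_and, augA_apply, augB, Finset.mul_sum]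
    refine Finset.sum_congr rfl fun s' _ => ?_
    rw [Finset.sum_eq_single s.2 (fun x _ hx => by simp [hx]) (by simp),
      Finset.sum_eq_single (ys (Fin.last k)) (fun y _ hy => by simp [hy]) (by simp)]
    by_cases hs : s'.1 = s.1
    · simp [hs]; ring
    · simp [hs]
  · have : ∀ x₀ x' u x y, F (measurements k ω) (pastControls k ω) x₀ x' u x y = 0 :=
      fun x₀ x' u x y => if_neg fun h => hω h.1
    simp [this]

theorem ae_law_historyEvent_ne_zero (M : ISCPOMDP X Y U) (π₀ : PMF X) (μ : HistoryPolicy Y U)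
    (k : ℕ) : ∀ᵐ ω ∂M.law π₀ μ,
      M.law π₀ μ (historyEvent k (measurements k ω) (pastControls k ω)) ≠ 0 := by
  rw [ae_iff]
  have hsub : {ω : Trajectory X Y U |
      ¬ M.law π₀ μ (historyEvent k (measurements k ω) (pastControls k ω)) ≠ 0} ⊆
      ⋃ z ∈ {z : (Fin k → Y) × (Fin k → U) | M.law π₀ μ (historyEvent k z.1 z.2) = 0},
        historyEvent k z.1 z.2 := by
    intro ω hω
    simp only [Set.mem_iUnion]
    exact ⟨(measurements k ω, pastControls k ω), not_not.1 hω, rfl, rfl⟩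
  refine measure_mono_null hsub ?_
  rw [measure_biUnion_null_iff (Set.to_countable _)]
  exact fun z hz => hz

theorem posterior_succ (M : ISCPOMDP X Y U) (π₀ : PMF X) (μ : HistoryPolicy Y U)
    (k : ℕ) (ys : Fin (k + 1) → Y) (us : Fin (k + 1) → U)
    (hus : us (Fin.last k) = μ k (Fin.init ys) (Fin.init us))
    (h : M.law π₀ μ (historyEvent (k + 1) ys us) ≠ 0) :
    M.posterior π₀ μ (k + 1) ys us =
      M.filter (M.posterior π₀ μ k (Fin.init ys) (Fin.init us)) (us (Fin.last k))
        (ys (Fin.last k)) := by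
  set w := M.filterWeight (M.posterior π₀ μ k (Fin.init ys) (Fin.init us)) (us (Fin.last k))
    (ys (Fin.last k)) with hw
  set L := M.law π₀ μ (historyEvent k (Fin.init ys) (Fin.init us)) with hL
  -- Summing the unnormalized rule over `s` identifies the normalizing constant.
  have key : ∀ s, M.law π₀ μ (historyEvent (k + 1) ys us) * M.posterior π₀ μ (k + 1) ys us s =
      L * w s := fun s => by
    rw [← law_historyEvent_inter, law_historyEvent_succ_inter M π₀ μ k ys us hus]
  have hsum : M.law π₀ μ (historyEvent (k + 1) ys us) = L * ∑' s, w s := by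
    rw [← ENNReal.tsum_mul_left, ← tsum_congr key, ENNReal.tsum_mul_left, PMF.tsum_coe, mul_one]
  have hL0 : L ≠ 0 := fun h0 => h (by rw [hsum, h0, zero_mul])
  have hLt : L ≠ ∞ := measure_ne_top _ _
  have hW0 : ∑' s, w s ≠ 0 := fun h0 => h (by rw [hsum, h0, mul_zero])
  have hWt : ∑' s, w s ≠ ∞ := fun ht => by
    rw [ht, ENNReal.mul_top hL0] at hsum
    exact measure_ne_top _ _ hsum
  rw [filter, dif_pos ⟨hW0, hWt⟩]
  ext s
  rw [PMF.normalize_apply, ← div_eq_mul_inv, ENNReal.eq_div_iff hW0 hWt]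
  have hk := key s
  rw [hsum, mul_assoc] at hk
  exact (ENNReal.mul_right_inj hL0 hLt).1 hk

theorem belief_succ_ae_eq (M : ISCPOMDP X Y U) (π₀ : PMF X) (μ : HistoryPolicy Y U) (k : ℕ) :
    ∀ᵐ ω ∂M.law π₀ μ, M.belief π₀ μ (k + 1) ω =
      M.filter (M.belief π₀ μ k ω) (control k ω) (measurements (k + 1) ω (Fin.last k)) := by
  filter_upwards [M.control_ae_eq π₀ μ k, M.ae_law_historyEvent_ne_zero π₀ μ (k + 1)] with ω hu hω
  exact M.posterior_succ π₀ μ k _ _ hu hω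

theorem belief_zero (M : ISCPOMDP X Y U) (π₀ : PMF X) (μ : HistoryPolicy Y U)
    (ω : Trajectory X Y U) : M.belief π₀ μ 0 ω = initialBelief π₀ := by
  have hH : (historyEvent 0 (measurements 0 ω) (pastControls 0 ω) : Set (Trajectory X Y U)) =
      Set.univ :=
    Set.eq_univ_of_forall fun _ => ⟨Subsingleton.elim _ _, Subsingleton.elim _ _⟩
  ext s
  have h := M.law_historyEvent_inter π₀ μ 0 (measurements 0 ω) (pastControls 0 ω) s
  rw [hH, measure_univ, one_mul, Set.univ_inter] at h
  rw [belief, ← h, ← PMF.toMeasure_apply_singleton _ _ (MeasurableSet.singleton s), initialBelief,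
    ← PMF.toMeasure_map _ _ Measurable.of_discrete,
    Measure.map_apply Measurable.of_discrete (MeasurableSet.singleton s)]
  have hfst : (M.law π₀ μ).fst = π₀.toMeasure := Measure.fst_compProd _ _
  rw [← hfst, Measure.fst_apply MeasurableSet.of_discrete]
  rfl

theorem cond_historyEvent_next (M : ISCPOMDP X Y U) (π₀ : PMF X) (μ : HistoryPolicy Y U) (k : ℕ)
    (ys : Fin k → Y) (us : Fin k → U) (y : Y)
    (h : M.law π₀ μ (historyEvent k ys us) ≠ 0) :
    (M.law π₀ μ)[|historyEvent k ys us] {ω | measurements (k + 1) ω (Fin.last k) = y} =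
      M.nextMeasurement (M.posterior π₀ μ k ys us) (μ k ys us) y := by
  classical
  have hH := measurableSet_historyEvent (X := X) k ys us
  have hY : MeasurableSet {ω : Trajectory X Y U | measurements (k + 1) ω (Fin.last k) = y} :=
    ((measurable_pi_apply (Fin.last k)).comp (measurable_measurements (k + 1)))
      (MeasurableSet.singleton y)
  have key : M.law π₀ μ (historyEvent k ys us ∩ {ω | measurements (k + 1) ω (Fin.last k) = y}) =
      M.nextMeasurement (M.posterior π₀ μ k ys us) (μ k ys us) y *
        M.law π₀ μ (historyEvent k ys us) := by
    rw [← lintegral_indicator_one (hH.inter hY), ← lintegral_indicator_const hH]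
    refine Eq.trans (lintegral_congr fun ω => ?_) ((M.lintegral_law_next π₀ μ k
      fun ys' us' _ y' => if (ys' = ys ∧ us' = us) ∧ y' = y then 1 else 0).trans
        (lintegral_congr fun ω => ?_))
    · rw [Set.indicator_apply]
      exact if_congr Iff.rfl rfl rfl
    · rw [Set.indicator_apply]
      split_ifs with hω
      · obtain ⟨hy, hu⟩ := hω
        simp [belief, hy, hu]
      · have : ∀ y', ¬ ((measurements k ω = ys ∧ pastControls k ω = us) ∧ y' = y) :=
          fun y' h => hω h.1
        simp [this]
  rw [cond_apply hH, key, mul_comm, mul_assoc, ENNReal.mul_inv_cancel h (measure_ne_top _ _),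
    mul_one]

end ISCPOMDP

/-! ### The belief processes as controlled processes -/

namespace ISCPOMDP

open Trajectory

section BeliefCost

variable {X Y U : Type*} [Fintype X]

/-- The augmented-belief decision process with running cost `ρ + K`. The truncation by `ofReal` is
harmless if `-K` is a lower bound of the costs. -/
noncomputable def toBeliefMDP (M : ISCPOMDP X Y U) (K : ℝ) : BeliefMDP (PMF (X × X)) U Y where
  p := M.nextMeasurement
  next := M.filter
  h ξ u := ENNReal.ofReal (M.rho ξ u + K)
  γ := ENNReal.ofReal M.γ

theorem rho_add_eq_sum (M : ISCPOMDP X Y U) (K : ℝ) (ξ : PMF (X × X)) (u : U) :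
    M.rho ξ u + K = ∑ s : X × X, (ξ s).toReal * (M.c s.1 s.2 u + M.ψ ξ u + K) := by
  have h1 : ∑ s : X × X, (ξ s).toReal = 1 := by
    rw [← ENNReal.toReal_sum fun s _ => ξ.apply_ne_top s, ← tsum_fintype (L := .unconditional _),
      ξ.tsum_coe, ENNReal.toReal_one]
  simp_rw [mul_add, Finset.sum_add_distrib, ← Finset.sum_mul, h1, rho]
  ring

theorem ofReal_rho_add (M : ISCPOMDP X Y U) {K : ℝ}
    (hK : ∀ x₀ x ξ u, -K ≤ M.c x₀ x u + M.ψ ξ u) (ξ : PMF (X × X)) (u : U) :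
    ENNReal.ofReal (M.rho ξ u + K) =
      ∑ s : X × X, ξ s * ENNReal.ofReal (M.c s.1 s.2 u + M.ψ ξ u + K) := by
  have h0 : ∀ s : X × X, 0 ≤ M.c s.1 s.2 u + M.ψ ξ u + K := fun s => by
    linarith [hK s.1 s.2 ξ u]
  rw [rho_add_eq_sum, ENNReal.ofReal_sum_of_nonneg fun s _ =>
    mul_nonneg ENNReal.toReal_nonneg (h0 s)]
  refine Finset.sum_congr rfl fun s _ => ?_
  rw [ENNReal.ofReal_mul ENNReal.toReal_nonneg, ENNReal.ofReal_toReal (ξ.apply_ne_top s)]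

theorem neg_le_rho (M : ISCPOMDP X Y U) {K : ℝ}
    (hK : ∀ x₀ x ξ u, -K ≤ M.c x₀ x u + M.ψ ξ u) (ξ : PMF (X × X)) (u : U) :
    -K ≤ M.rho ξ u := by
  rw [neg_le_iff_add_nonneg, rho_add_eq_sum]
  exact Finset.sum_nonneg fun s _ =>
    mul_nonneg ENNReal.toReal_nonneg (by linarith [hK s.1 s.2 ξ u])

theorem exists_neg_le_cost [Fintype U] (M : ISCPOMDP X Y U) (hψ : ∃ m : ℝ, ∀ ξ u, m ≤ M.ψ ξ u) :
    ∃ K : ℝ, 0 ≤ K ∧ ∀ x₀ x ξ u, -K ≤ M.c x₀ x u + M.ψ ξ u := by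
  obtain ⟨m, hm⟩ := hψ
  refine ⟨∑ z : X × X × U, |M.c z.1 z.2.1 z.2.2| + |m|, by positivity, fun x₀ x ξ u => ?_⟩
  have h1 : |M.c x₀ x u| ≤ ∑ z : X × X × U, |M.c z.1 z.2.1 z.2.2| :=
    Finset.single_le_sum (f := fun z : X × X × U => |M.c z.1 z.2.1 z.2.2|)
      (fun _ _ => abs_nonneg _) (Finset.mem_univ (x₀, x, u))
  linarith [neg_abs_le (M.c x₀ x u), neg_abs_le m, hm ξ u]

/-- Shifting the running cost by `K` turns the expected discounted belief cost of any controlled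
belief process into a nonnegative total cost, up to a constant. -/
theorem expectedDiscountedCost_rho [Fintype Y] (M : ISCPOMDP X Y U) (hγ_pos : 0 < M.γ)
    (hγ_lt : M.γ < 1) {K : ℝ} (hK₀ : 0 ≤ K) (hK : ∀ x₀ x ξ u, -K ≤ M.c x₀ x u + M.ψ ξ u)
    {Ω : Type*} [MeasurableSpace Ω] {P : Measure Ω} [IsProbabilityMeasure P]
    {ξ : ℕ → Ω → PMF (X × X)} {u : ℕ → Ω → U} (hP : (M.toBeliefMDP K).IsControlled P ξ u) :
    (expectedDiscountedCost P M.γ fun k ω => M.rho (ξ k ω) (u k ω)) =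
      ((∑' k, (M.toBeliefMDP K).γ ^ k * ∫⁻ ω, (M.toBeliefMDP K).h (ξ k ω) (u k ω) ∂P : ℝ≥0∞) :
        EReal) - ((∑' k, ENNReal.ofReal M.γ ^ k * ENNReal.ofReal K : ℝ≥0∞) : EReal) :=
  expectedDiscountedCost_eq_sub P hγ_pos.le hγ_lt hK₀ (fun k => hP.measurable_comp k M.rho)
    fun _ _ => M.neg_le_rho hK _ _

end BeliefCost

variable {X Y U : Type*} [Fintype X]
  [Fintype Y] [MeasurableSpace Y] [DiscreteMeasurableSpace Y]

instance (M : ISCPOMDP X Y U) (ξ₀ : PMF (X × X)) (ν : PMF (X × X) → U) :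
    IsProbabilityMeasure (M.beliefLaw ξ₀ ν) := by
  unfold beliefLaw
  infer_instance

theorem isControlled_beliefLaw (M : ISCPOMDP X Y U) (K : ℝ) (ξ₀ : PMF (X × X))
    (ν : PMF (X × X) → U) :
    (M.toBeliefMDP K).IsControlled (M.beliefLaw ξ₀ ν)
      (fun k ω => M.closedLoopBelief ξ₀ ν k fun i => ω i)
      (fun k ω => ν (M.closedLoopBelief ξ₀ ν k fun i => ω i)) where
  measurable k := by
    have h : Measurable[_, ⊤] fun ys : Fin k → Y =>
        (M.closedLoopBelief ξ₀ ν k ys, ν (M.closedLoopBelief ξ₀ ν k ys)) :=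
      @Measurable.of_discrete _ _ _ ⊤ _ _
    have hr : Measurable fun (ω : ℕ → Y) (i : Fin k) => ω i := by fun_prop
    exact h.comp hr
  lintegral_next k F := by
    refine (lintegral_seqLaw _ k fun ys y => F (M.filter (M.closedLoopBelief ξ₀ ν k ys)
      (ν (M.closedLoopBelief ξ₀ ν k ys)) y)).trans ?_
    simp_rw [tsum_fintype]
    rfl

variable [MeasurableSpace X] [DiscreteMeasurableSpace X]
  [Fintype U] [MeasurableSpace U] [DiscreteMeasurableSpace U]

theorem isControlled_law (M : ISCPOMDP X Y U) (K : ℝ) (π₀ : PMF X) (μ : HistoryPolicy Y U) :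
    (M.toBeliefMDP K).IsControlled (M.law π₀ μ) (M.belief π₀ μ) control where
  measurable k := by
    have h : Measurable[_, ⊤] fun z : ((Fin k → Y) × (Fin k → U)) × U =>
        (M.posterior π₀ μ k z.1.1 z.1.2, z.2) :=
      @Measurable.of_discrete _ _ _ ⊤ _ _
    exact h.comp (measurable_history_control k)
  lintegral_next k F := by
    calc ∫⁻ ω, F (M.belief π₀ μ (k + 1) ω) ∂M.law π₀ μ
        = ∫⁻ ω, F (M.filter (M.posterior π₀ μ k (measurements k ω) (pastControls k ω))
            (control k ω) (ω.2 k).2.2) ∂M.law π₀ μ :=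
          lintegral_congr_ae ((M.belief_succ_ae_eq π₀ μ k).mono fun ω hω => congrArg F hω)
      _ = _ := M.lintegral_law_next π₀ μ k fun ys us u y =>
            F (M.filter (M.posterior π₀ μ k ys us) u y)
      _ = ∫⁻ ω, (M.toBeliefMDP K).expNext F (M.belief π₀ μ k ω) (control k ω) ∂M.law π₀ μ :=
          lintegral_congr_ae ((M.control_ae_eq π₀ μ k).mono fun ω hω => by
            simp only [hω]
            rfl)

theorem lintegral_law_cost (M : ISCPOMDP X Y U) {K : ℝ}
    (hK : ∀ x₀ x ξ u, -K ≤ M.c x₀ x u + M.ψ ξ u) (π₀ : PMF X) (μ : HistoryPolicy Y U) (k : ℕ) :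
    ∫⁻ ω, ENNReal.ofReal (M.c (state 0 ω) (state k ω) (control k ω) +
        M.ψ (M.belief π₀ μ k ω) (control k ω) + K) ∂M.law π₀ μ =
      ∫⁻ ω, ENNReal.ofReal (M.rho (M.belief π₀ μ k ω) (control k ω) + K) ∂M.law π₀ μ := by
  have hu := M.control_ae_eq π₀ μ k
  calc _ = ∫⁻ ω, ENNReal.ofReal (M.c (state 0 ω) (state k ω)
            (μ k (measurements k ω) (pastControls k ω)) +
          M.ψ (M.posterior π₀ μ k (measurements k ω) (pastControls k ω))
            (μ k (measurements k ω) (pastControls k ω)) + K) ∂M.law π₀ μ :=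
        lintegral_congr_ae (hu.mono fun ω hω => by simp only [hω]; rfl)
    _ = _ := M.lintegral_law_belief π₀ μ k fun ys us x₀ x =>
          ENNReal.ofReal (M.c x₀ x (μ k ys us) + M.ψ (M.posterior π₀ μ k ys us) (μ k ys us) + K)
    _ = _ := lintegral_congr_ae (hu.mono fun ω hω => by
          simp only [hω, ofReal_rho_add M hK]
          rfl)

theorem cost_eq_expectedDiscountedCost_rho (M : ISCPOMDP X Y U) (hγ_pos : 0 < M.γ)
    (hγ_lt : M.γ < 1) {K : ℝ} (hK₀ : 0 ≤ K) (hK : ∀ x₀ x ξ u, -K ≤ M.c x₀ x u + M.ψ ξ u)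
    (π₀ : PMF X) (μ : HistoryPolicy Y U) :
    M.cost π₀ μ = expectedDiscountedCost (M.law π₀ μ) M.γ fun k ω =>
      M.rho (M.belief π₀ μ k ω) (control k ω) := by
  have hm : ∀ k, Measurable fun ω : Trajectory X Y U =>
      M.c (state 0 ω) (state k ω) (control k ω) + M.ψ (M.belief π₀ μ k ω) (control k ω) := by
    intro k
    have h : Measurable fun z : (X × X) × (((Fin k → Y) × (Fin k → U)) × U) =>
        M.c z.1.1 z.1.2 z.2.2 + M.ψ (M.posterior π₀ μ k z.2.1.1 z.2.1.2) z.2.2 :=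
      Measurable.of_discrete
    exact h.comp (((measurable_state 0).prodMk (measurable_state k)).prodMk
      (measurable_history_control k))
  rw [M.expectedDiscountedCost_rho hγ_pos hγ_lt hK₀ hK (M.isControlled_law K π₀ μ), cost,
    expectedDiscountedCost_eq_sub _ hγ_pos.le hγ_lt hK₀ hm fun _ _ => hK _ _ _ _]
  simp_rw [M.lintegral_law_cost hK]
  rfl

theorem belief_toHistoryPolicy_ae_eq (M : ISCPOMDP X Y U) (π₀ : PMF X) (ν : PMF (X × X) → U)
    (k : ℕ) : ∀ᵐ ω ∂M.law π₀ (M.toHistoryPolicy π₀ ν), M.belief π₀ (M.toHistoryPolicy π₀ ν) k ω =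
      M.filterRun (initialBelief π₀) k (measurements k ω) (pastControls k ω) := by
  induction k with
  | zero => exact .of_forall fun ω => M.belief_zero π₀ _ ω
  | succ k ih =>
    filter_upwards [ih, M.belief_succ_ae_eq π₀ (M.toHistoryPolicy π₀ ν) k] with ω h1 h2
    rw [h2, h1]
    rfl

theorem control_toHistoryPolicy_ae_eq (M : ISCPOMDP X Y U) (π₀ : PMF X) (ν : PMF (X × X) → U)
    (k : ℕ) : ∀ᵐ ω ∂M.law π₀ (M.toHistoryPolicy π₀ ν),
      control k ω = ν (M.belief π₀ (M.toHistoryPolicy π₀ ν) k ω) := by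
  filter_upwards [M.control_ae_eq π₀ (M.toHistoryPolicy π₀ ν) k,
    M.belief_toHistoryPolicy_ae_eq π₀ ν k] with ω h1 h2
  rw [h1, h2]
  rfl

end ISCPOMDP

/-! ### Equivalence of the two problems -/

theorem theorem1 {X Y U : Type*}
    [Fintype X] [MeasurableSpace X] [DiscreteMeasurableSpace X]
    [Fintype Y] [MeasurableSpace Y] [DiscreteMeasurableSpace Y]
    [Fintype U] [Nonempty U] [MeasurableSpace U] [DiscreteMeasurableSpace U]
    (M : ISCPOMDP X Y U) (hγ_pos : 0 < M.γ) (hγ_lt : M.γ < 1)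
    (hψ : ∃ m : ℝ, ∀ ξ u, m ≤ M.ψ ξ u) :
    -- under every history policy, the joint posterior is a controlled Markov process that obeys the
    -- constraints of the belief MDP, and the cost is the expected discounted belief cost
    (∀ (π₀ : PMF X) (μ : HistoryPolicy Y U),
      (∀ ω, M.belief π₀ μ 0 ω = ISCPOMDP.initialBelief π₀) ∧
      (∀ k, ∀ᵐ ω ∂M.law π₀ μ, M.belief π₀ μ (k + 1) ω =
        M.filter (M.belief π₀ μ k ω) (Trajectory.control k ω)
          (Trajectory.measurements (k + 1) ω (Fin.last k))) ∧
      (∀ k (ys : Fin k → Y) (us : Fin k → U) (y : Y),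
        M.law π₀ μ (Trajectory.historyEvent k ys us) ≠ 0 →
        (M.law π₀ μ)[|Trajectory.historyEvent k ys us]
            {ω | Trajectory.measurements (k + 1) ω (Fin.last k) = y} =
          M.nextMeasurement (M.posterior π₀ μ k ys us) (μ k ys us) y) ∧
      M.cost π₀ μ = expectedDiscountedCost (M.law π₀ μ) M.γ fun k ω =>
        M.rho (M.belief π₀ μ k ω) (Trajectory.control k ω)) ∧
    -- a belief policy has the same cost in both problems
    (∀ (π₀ : PMF X) (ν : PMF (X × X) → U),
      M.cost π₀ (M.toHistoryPolicy π₀ ν) = M.beliefCost (ISCPOMDP.initialBelief π₀) ν) ∧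
    -- both problems have the same value
    (∀ π₀ : PMF X,
      ⨅ μ : HistoryPolicy Y U, M.cost π₀ μ =
        ⨅ ν : PMF (X × X) → U, M.beliefCost (ISCPOMDP.initialBelief π₀) ν) ∧
    -- one stationary belief policy is optimal in both problems, for every initial condition
    ∃ ν : PMF (X × X) → U,
      (∀ ξ₀ : PMF (X × X),
        M.beliefCost ξ₀ ν = ⨅ ν' : PMF (X × X) → U, M.beliefCost ξ₀ ν') ∧
      ∀ π₀ : PMF X,
        M.cost π₀ (M.toHistoryPolicy π₀ ν) = ⨅ μ : HistoryPolicy Y U, M.cost π₀ μ := by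

  obtain ⟨K, hK₀, hK⟩ := M.exists_neg_le_cost hψ
  -- `D` has the shifted costs `ρ + K ≥ 0`, and `C` is the total discounted amount of the shift.
  set D := M.toBeliefMDP K with hD
  set C : EReal := ((∑' k, ENNReal.ofReal M.γ ^ k * ENNReal.ofReal K : ℝ≥0∞) : EReal)
  have hcost := M.cost_eq_expectedDiscountedCost_rho hγ_pos hγ_lt hK₀ hK
  have hlaw : ∀ π₀ μ, M.cost π₀ μ = ((∑' k, D.γ ^ k * ∫⁻ ω, D.h (M.belief π₀ μ k ω)
      (Trajectory.control k ω) ∂M.law π₀ μ : ℝ≥0∞) : EReal) - C := fun π₀ μ => by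
    rw [hcost, M.expectedDiscountedCost_rho hγ_pos hγ_lt hK₀ hK (M.isControlled_law K π₀ μ)]
  have hbel : ∀ ξ₀ ν, M.beliefCost ξ₀ ν = ((∑' k, D.γ ^ k * ∫⁻ ω,
      D.h (M.closedLoopBelief ξ₀ ν k fun i => ω i)
        (ν (M.closedLoopBelief ξ₀ ν k fun i => ω i)) ∂M.beliefLaw ξ₀ ν : ℝ≥0∞) : EReal) - C :=
    fun ξ₀ ν =>
      M.expectedDiscountedCost_rho hγ_pos hγ_lt hK₀ hK (M.isControlled_beliefLaw K ξ₀ ν)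
  have hsame : ∀ (π₀ : PMF X) (ν : PMF (X × X) → U),
      M.cost π₀ (M.toHistoryPolicy π₀ ν) = M.beliefCost (ISCPOMDP.initialBelief π₀) ν := by
    intro π₀ ν
    have hu := M.control_toHistoryPolicy_ae_eq π₀ ν
    rw [hlaw, hbel]
    refine congrArg (fun a : ℝ≥0∞ => (a : EReal) - C)
      (tsum_congr fun k => congrArg (D.γ ^ k * ·) ?_)
    rw [lintegral_congr_ae ((hu k).mono fun ω hω => congrArg (D.h _) hω)]
    exact ((M.isControlled_law K π₀ _).lintegral_eq_iterate (M.belief_zero π₀ _) hu k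
      fun ξ => D.h ξ (ν ξ)).trans ((M.isControlled_beliefLaw K _ ν).lintegral_eq_iterate
        (fun _ => rfl) (fun _ => .of_forall fun _ => rfl) k fun ξ => D.h ξ (ν ξ)).symm
  obtain ⟨ν, hν⟩ := D.exists_greedy
  have hopt : ∀ ξ₀, M.beliefCost ξ₀ ν = (D.value ξ₀ : EReal) - C := fun ξ₀ => by
    rw [hbel, (M.isControlled_beliefLaw K ξ₀ ν).cost_eq_value (fun _ => rfl)
      (fun _ => .of_forall fun _ => rfl) hν]
  have hlower : ∀ ξ₀ ν', (D.value ξ₀ : EReal) - C ≤ M.beliefCost ξ₀ ν' := fun ξ₀ ν' => by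
    rw [hbel]
    exact EReal.sub_le_sub (EReal.coe_ennreal_le_coe_ennreal_iff.2
      ((M.isControlled_beliefLaw K ξ₀ ν').value_le fun _ => rfl)) le_rfl
  have hlower' : ∀ π₀ μ, (D.value (ISCPOMDP.initialBelief π₀) : EReal) - C ≤ M.cost π₀ μ :=
    fun π₀ μ => by
      rw [hlaw]
      exact EReal.sub_le_sub (EReal.coe_ennreal_le_coe_ennreal_iff.2
        ((M.isControlled_law K π₀ μ).value_le (M.belief_zero π₀ μ))) le_rfl
  have hinf : ∀ ξ₀, ⨅ ν', M.beliefCost ξ₀ ν' = (D.value ξ₀ : EReal) - C := fun ξ₀ =>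
    le_antisymm ((iInf_le _ ν).trans_eq (hopt ξ₀)) (le_iInf (hlower ξ₀))
  have hinf' : ∀ π₀, ⨅ μ, M.cost π₀ μ = (D.value (ISCPOMDP.initialBelief π₀) : EReal) - C :=
    fun π₀ => le_antisymm ((iInf_le _ (M.toHistoryPolicy π₀ ν)).trans_eq
      ((hsame π₀ ν).trans (hopt _))) (le_iInf (hlower' π₀))
  exact ⟨fun π₀ μ => ⟨M.belief_zero π₀ μ, M.belief_succ_ae_eq π₀ μ,
      M.cond_historyEvent_next π₀ μ, hcost π₀ μ⟩, hsame,
    fun π₀ => (hinf' π₀).trans (hinf _).symm, ν, fun ξ₀ => (hopt ξ₀).trans (hinf ξ₀).symm,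
    fun π₀ => ((hsame π₀ ν).trans (hopt _)).trans (hinf' π₀).symm⟩
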